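/- **Conventions.** All spaces $\mathbb{R}^d$ and all products of them carry the Euclidean inner product and norm. $t_k\downarrow 0$ means $t_k>0$, $t_k\to0$. A sequence $(z_k)$ converges to $z$ *from* $w$ if $z_k=z+t_kw_k$ for some $t_k\downarrow0$, $w_k\to w$. *Cones.* For $\Omega\subset\mathbb{R}^d$ and $\bar z\in\Omega$ put $T_\Omega(\bar z)=\{w\mid\exists t_k\downarrow0,\,w_k\to w:\ \bar z+t_kw_k\in\Omega\ \forall k\}$, $\widehat N_\Omega(\bar z)=\{z^*\mid\langle z^*,w\rangle\le0\ \forall w\in T_\Omega(\bar z)\}$, $N_\Omega(\bar z)=\{z^*\mid\exists z_k\to\bar z,\,z_k^*\to z^*:\ z_k^*\in\widehat N_\Omega(z_k)\ \forall k\}$, $N_\Omega(\bar z;w)=\{z^*\mid\exists t_k\downarrow0,\,w_k\to w,\,z_k^*\to z^*:\ z^*_k\in\widehat N_\Omega(\bar z+t_kw_k)\ \forall k\}$; all these sets are empty for $\bar z\notin\Omega$. *Derivatives.* For a set-valued mapping $M\colon\mathbb{R}^a\rightrightarrows\mathbb{R}^b$ let $\mathrm{gph}\,M=\{(y,x)\mid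 x\in M(y)\}$, $\mathrm{dom}\,M=\{y\mid M(y)\ne\varnothing\}$, $M^{-1}(x)=\{y\mid x\in M(y)\}$. For $(\bar y,\bar x)\in\mathrm{gph}\,M$ let $DM(\bar y,\bar x)(v)=\{u\mid(v,u)\in T_{\mathrm{gph}\,M}(\bar y,\bar x)\}$ (graphical derivative), $\widehat D^*M(\bar y,\bar x)(x^*)=\{y^*\mid(y^*,-x^*)\in\widehat N_{\mathrm{gph}\,M}(\bar y,\bar x)\}$ (regular coderivative), $D^*M(\bar y,\bar x)(x^*)=\{y^*\mid(y^*,-x^*)\in N_{\mathrm{gph}\,M}(\bar y,\bar x)\}$ (limiting coderivative), $D^*M((\bar y,\bar x);(v,u))(x^*)=\{y^*\mid(y^*,-x^*)\in N_{\mathrm{gph}\,M}((\bar y,\bar x);(v,u))\}$ (directional limiting coderivative). *Stability.* Let $\bar y\in\mathrm{dom}\,M$, $\Omega\subset\mathbb{R}^a$. - $M$ is *inner semicompact* at $\bar y$ w.r.t. $\Omega$ if for each $(y_k)\subset\Omega$ with $y_k\to\bar y$ there are $\bar x$ and $(x_k)$ such that $x_k\to\bar x$ and $x_k\in M(y_k)$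 along a subsequence. - $M$ is *inner calm\** at $\bar y$ w.r.t. $\Omega$ in direction $v$ if there is $\kappa>0$ such that for each $(y_k)\subset\Omega$ converging to $\bar y$ from $v$ there are $\bar x$ and $(x_k)$ such that $x_k\in M(y_k)$ and $\|x_k-\bar x\|\le\kappa\|y_k-\bar y\|$ along a subsequence. - $M$ is *inner calm\* in the fuzzy sense* at $\bar y$ w.r.t. $\Omega$ if for every unit vector $v\in T_\Omega(\bar y)$ there are $\kappa>0$, a sequence $(y_k)\subset\Omega$ converging to $\bar y$ from $v$, a point $\bar x$ and $x_k\in M(y_k)$ with $\|x_k-\bar x\|\le\kappa\|y_k-\bar y\|$ for all $k$. - $M$ is *calm* at $(\bar y,\bar x)\in\mathrm{gph}\,M$ if there is $\kappa>0$ such that for all sequences $x_k\to\bar x$ and $(y_k)$ with $x_k\in M(y_k)$ for all $k$ there is $(\tilde x_k)\subset M(\bar y)$ with $\|x_k-\tilde x_k\|\le\kappa\|y_k-\bar y\|$ for all large $k$. It is *calm in direction* $u\in\mathbb{R}^b$ if this holds for those $(x_k)$ that converge to $\bar x$ from $u$. **Theorem.** Let $S_1\colon\mathbb{R}^n\rightrightarrows\mathbb{R}^m$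 and $S_2\colon\mathbb{R}^m\rightrightarrows\mathbb{R}^\ell$ have closed graphs, and let $S=S_2\circ S_1$, i.e. $S(x)=\bigcup_{y\in S_1(x)}S_2(y)$; compositions of derivatives below are meant in the same sense. Put $$\Xi(x,z)=S_1(x)\cap S_2^{-1}(z),\qquad M(p,q)=\{(x,z,y)\mid y+p\in S_1(x),\ z+q\in S_2(y)\}.$$ Let $(\bar x,\bar z)\in\mathrm{gph}\,S$ be a point at which $\mathrm{gph}\,S$ is locally closed (i.e. $\mathrm{gph}\,S\cap V$ is closed for some closed neighbourhood $V$ of $(\bar x,\bar z)$). Then: **(D)** If $\Xi$ is inner calm\* at $(\bar x,\bar z)$ w.r.t. $\mathrm{dom}\,\Xi$ in the fuzzy sense, then for all $u\in\mathbb{R}^n$ $$DS(\bar x,\bar z)(u)\subset\bigcup_{\bar y\in\Xi(\bar x,\bar z)}\bigl(DS_2(\bar y,\bar z)\circ DS_1(\bar x,\bar y)\bigr)(u).$$ The opposite inclusion holds for all $u$ if, for all $\bar y\in\Xi(\bar x,\bar z)$, $M$ is calm at $((0,0),(\bar x,\bar z,\bar y))$ and, for all $(u,v,w)\in\mathbb{R}^n\times\mathbb{R}^m\times\mathbb{R}^\ell$,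 $$((u,v),(v,w))\in T_{\mathrm{gph}\,S_1\times\mathrm{gph}\,S_2}((\bar x,\bar y),(\bar y,\bar z))\iff v\in DS_1(\bar x,\bar y)(u),\ w\in DS_2(\bar y,\bar z)(v).$$ **($\widehat{\mathrm D}^*$)** If $\Xi$ is inner calm\* at $(\bar x,\bar z)$ w.r.t. $\mathrm{dom}\,\Xi$ in the fuzzy sense, then for all $z^*\in\mathbb{R}^\ell$ $$\widehat D^*S(\bar x,\bar z)(z^*)\supset\bigcap_{\bar y\in\Xi(\bar x,\bar z)}\bigl(\widehat D^*S_1(\bar x,\bar y)\circ\widehat D^*S_2(\bar y,\bar z)\bigr)(z^*).$$ If $M$ is calm at $((0,0),(\bar x,\bar z,\bar y))$ for each $\bar y\in\Xi(\bar x,\bar z)$, then for all $z^*\in\mathbb{R}^\ell$ $$\widehat D^*S(\bar x,\bar z)(z^*)\subset\bigcap_{\bar y\in\Xi(\bar x,\bar z)}\bigl(D^*S_1(\bar x,\bar y)\circ D^*S_2(\bar y,\bar z)\bigr)(z^*).$$ **(D\*)** If $\Xi$ is inner semicompact at $(\bar x,\bar z)$ w.r.t. $\mathrm{dom}\,\Xi$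 and $M$ is calm at $((0,0),(\bar x,\bar z,\bar y))$ for each $\bar y\in\Xi(\bar x,\bar z)$, then for all $z^*\in\mathbb{R}^\ell$ $$D^*S(\bar x,\bar z)(z^*)\subset\bigcup_{\bar y\in\Xi(\bar x,\bar z)}\bigl(D^*S_1(\bar x,\bar y)\circ D^*S_2(\bar y,\bar z)\bigr)(z^*).$$ **(dD\*)** Let $(u,w)\in\mathbb{R}^n\times\mathbb{R}^\ell$. If $\Xi$ is inner calm\* at $(\bar x,\bar z)$ w.r.t. $\mathrm{dom}\,\Xi$ in direction $(u,w)$ and, for each $\bar y\in\Xi(\bar x,\bar z)$ and each $v\in D\Xi((\bar x,\bar z),\bar y)(u,w)$, $M$ is calm at $((0,0),(\bar x,\bar z,\bar y))$ in direction $(u,w,v)$, then for all $z^*\in\mathbb{R}^\ell$ $$D^*S((\bar x,\bar z);(u,w))(z^*)\subset\bigcup_{\bar y\in\Xi(\bar x,\bar z)}\ \bigcup_{v\in D\Xi((\bar x,\bar z),\bar y)(u,w)}\bigl(D^*S_1((\bar x,\bar y);(u,v))\circ D^*S_2((\bar y,\bar z);(v,w))\bigr)(z^*).$$ -/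

import Mathlib

open Filter Topology

namespace VariationalAnalysis

/-- The product of two Euclidean spaces with the Euclidean inner product and norm
(the plain product type would carry the maximum norm). -/
abbrev EProd (E F : Type*) : Type _ := WithLp 2 (E × F)

/-- The pair `(a, b)` as an element of the Euclidean product. -/
abbrev pair {E F : Type*} (a : E) (b : F) : EProd E F := WithLp.toLp 2 (a, b)

/-! ### Set-valued mappings -/

/-- Graph of a set-valued mapping. -/
def gph {E F : Type*} (M : E → Set F) : Set (EProd E F) := {p | p.snd ∈ M p.fst}

/-- Domain of a set-valued mapping. -/
def dom {E F : Type*} (M : E → Set F) : Set E := {y | (M y).Nonempty}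

/-- Inverse of a set-valued mapping. -/
def inv {E F : Type*} (M : E → Set F) : F → Set E := fun x => {y | x ∈ M y}

/-- Composition `S₂ ∘ S₁` of set-valued mappings. -/
def compose {E F G : Type*} (S₂ : F → Set G) (S₁ : E → Set F) : E → Set G :=
  fun x => ⋃ y ∈ S₁ x, S₂ y

/-- The intermediate mapping `Ξ(x, z) = S₁(x) ∩ S₂⁻¹(z)`. -/
def intermediate {E F G : Type*} (S₁ : E → Set F) (S₂ : F → Set G) : EProd E G → Set F :=
  fun p => S₁ p.fst ∩ inv S₂ p.snd

/-- The perturbation mapping `M(p, q) = {(x, z, y) | y + p ∈ S₁(x), z + q ∈ S₂(y)}`. -/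
def perturbation {E F G : Type*} [Add F] [Add G] (S₁ : E → Set F) (S₂ : F → Set G) :
    EProd F G → Set (EProd E (EProd G F)) :=
  fun pq => {t | t.snd.snd + pq.fst ∈ S₁ t.fst ∧ t.snd.fst + pq.snd ∈ S₂ t.snd.snd}

/-- The product of two sets, as a subset of the Euclidean product. -/
def setProd {E F : Type*} (A : Set E) (B : Set F) : Set (EProd E F) :=
  {p | p.fst ∈ A ∧ p.snd ∈ B}

/-- `Ω` is locally closed at `z`. -/
def LocallyClosedAt {E : Type*} [TopologicalSpace E] (Ω : Set E) (z : E) : Prop :=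
  ∃ V ∈ 𝓝 z, IsClosed V ∧ IsClosed (Ω ∩ V)

section Cones

variable {E : Type*} [NormedAddCommGroup E] [InnerProductSpace ℝ E]

/-- The sequence `(zs k)` converges to `z` from the direction `w`. -/
def ConvergesFrom (zs : ℕ → E) (z w : E) : Prop :=
  ∃ (t : ℕ → ℝ) (ws : ℕ → E), (∀ k, 0 < t k) ∧ Tendsto t atTop (𝓝 0) ∧
    Tendsto ws atTop (𝓝 w) ∧ ∀ k, zs k = z + t k • ws k

/-- The polar cone. -/
def polar (C : Set E) : Set E := {zs | ∀ z ∈ C, inner ℝ zs z ≤ 0}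

/-- The tangent (Bouligand, contingent) cone to `Ω` at `z`; empty if `z ∉ Ω`. -/
def tangentCone (Ω : Set E) (z : E) : Set E :=
  {w | z ∈ Ω ∧ ∃ (t : ℕ → ℝ) (ws : ℕ → E), (∀ k, 0 < t k) ∧ Tendsto t atTop (𝓝 0) ∧
    Tendsto ws atTop (𝓝 w) ∧ ∀ k, z + t k • ws k ∈ Ω}

/-- The regular (Fréchet) normal cone to `Ω` at `z`; empty if `z ∉ Ω`. -/
def regularNormal (Ω : Set E) (z : E) : Set E :=
  {zs | z ∈ Ω ∧ zs ∈ polar (tangentCone Ω z)}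

/-- The limiting (Mordukhovich) normal cone to `Ω` at `z`; empty if `z ∉ Ω`. -/
def limitingNormal (Ω : Set E) (z : E) : Set E :=
  {n | z ∈ Ω ∧ ∃ (zs ns : ℕ → E), Tendsto zs atTop (𝓝 z) ∧ Tendsto ns atTop (𝓝 n) ∧
    ∀ k, ns k ∈ regularNormal Ω (zs k)}

/-- The directional limiting normal cone to `Ω` at `z` in direction `w`; empty if `z ∉ Ω`. -/
def dirLimitingNormal (Ω : Set E) (z w : E) : Set E :=
  {n | z ∈ Ω ∧ ∃ (t : ℕ → ℝ) (ws ns : ℕ → E), (∀ k, 0 < t k) ∧ Tendsto t atTop (𝓝 0) ∧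
    Tendsto ws atTop (𝓝 w) ∧ Tendsto ns atTop (𝓝 n) ∧
    ∀ k, ns k ∈ regularNormal Ω (z + t k • ws k)}

end Cones

section Mappings

variable {E F : Type*} [NormedAddCommGroup E] [InnerProductSpace ℝ E]
  [NormedAddCommGroup F] [InnerProductSpace ℝ F]

/-! ### Generalized derivatives of `M` at a point `(y, x)` of its graph -/

/-- Graphical derivative `DM(y, x)`. -/
def graphicalDeriv (M : E → Set F) (y : E) (x : F) : E → Set F :=
  fun v => {u | pair v u ∈ tangentCone (gph M) (pair y x)}

/-- Regular coderivative. -/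
def regularCoderiv (M : E → Set F) (y : E) (x : F) : F → Set E :=
  fun xs => {ys | pair ys (-xs) ∈ regularNormal (gph M) (pair y x)}

/-- Limiting coderivative `D*M(y, x)`. -/
def limitingCoderiv (M : E → Set F) (y : E) (x : F) : F → Set E :=
  fun xs => {ys | pair ys (-xs) ∈ limitingNormal (gph M) (pair y x)}

/-- Directional limiting coderivative `D*M((y, x); (v, u))`. -/
def dirLimitingCoderiv (M : E → Set F) (y : E) (x : F) (v : E) (u : F) : F → Set E :=
  fun xs => {ys | pair ys (-xs) ∈ dirLimitingNormal (gph M) (pair y x) (pair v u)}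

/-! ### Stability notions -/

/-- Inner semicompactness of `M` at `y` with respect to `Ω`. -/
def InnerSemicompactAt (M : E → Set F) (y : E) (Ω : Set E) : Prop :=
  ∀ ys : ℕ → E, (∀ k, ys k ∈ Ω) → Tendsto ys atTop (𝓝 y) →
    ∃ (x : F) (xs : ℕ → F) (φ : ℕ → ℕ), StrictMono φ ∧
      Tendsto (fun k => xs (φ k)) atTop (𝓝 x) ∧ ∀ k, xs (φ k) ∈ M (ys (φ k))

/-- Inner calmness* of `M` at `y` with respect to `Ω` in direction `v`. -/
def InnerCalmStarAtDir (M : E → Set F) (y : E) (Ω : Set E) (v : E) : Prop :=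
  ∃ κ : ℝ, 0 < κ ∧ ∀ ys : ℕ → E, (∀ k, ys k ∈ Ω) → ConvergesFrom ys y v →
    ∃ (x : F) (xs : ℕ → F) (φ : ℕ → ℕ), StrictMono φ ∧
      ∀ k, ‖xs (φ k) - x‖ ≤ κ * ‖ys (φ k) - y‖ ∧ xs (φ k) ∈ M (ys (φ k))

/-- Inner calmness* in the fuzzy sense of `M` at `y` with respect to `Ω` in direction `v`. -/
def FuzzyInnerCalmStarAtDir (M : E → Set F) (y : E) (Ω : Set E) (v : E) : Prop :=
  v ∉ tangentCone Ω y ∨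
    ∃ κ : ℝ, 0 < κ ∧ ∃ (ys : ℕ → E) (x : F) (xs : ℕ → F),
      (∀ k, ys k ∈ Ω) ∧ ConvergesFrom ys y v ∧
      ∀ k, xs k ∈ M (ys k) ∧ ‖xs k - x‖ ≤ κ * ‖ys k - y‖

/-- Inner calmness* in the fuzzy sense of `M` at `y` with respect to `Ω`: in all unit directions. -/
def FuzzyInnerCalmStarAt (M : E → Set F) (y : E) (Ω : Set E) : Prop :=
  ∀ v : E, ‖v‖ = 1 → FuzzyInnerCalmStarAtDir M y Ω v

/-- Calmness of `M` at the point `(y, x)` of its graph. -/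
def CalmAt (M : E → Set F) (y : E) (x : F) : Prop :=
  ∃ κ : ℝ, 0 < κ ∧ ∀ (xs : ℕ → F) (ys : ℕ → E), Tendsto xs atTop (𝓝 x) →
    (∀ k, xs k ∈ M (ys k)) →
    ∃ xs' : ℕ → F, (∀ k, xs' k ∈ M y) ∧ ∀ᶠ k in atTop, ‖xs k - xs' k‖ ≤ κ * ‖ys k - y‖

/-- Calmness of `M` at the point `(y, x)` of its graph in direction `u` (in the range space). -/
def CalmAtDir (M : E → Set F) (y : E) (x u : F) : Prop :=
  ∃ κ : ℝ, 0 < κ ∧ ∀ (xs : ℕ → F) (ys : ℕ → E), ConvergesFrom xs x u →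
    (∀ k, xs k ∈ M (ys k)) →
    ∃ xs' : ℕ → F, (∀ k, xs' k ∈ M y) ∧ ∀ᶠ k in atTop, ‖xs k - xs' k‖ ≤ κ * ‖ys k - y‖

end Mappings

/-- The tangent product condition at `((x, y), (y, z))`: a vector `((u, v), (v, w))` is tangent to
`gph S₁ × gph S₂` exactly if `v ∈ DS₁(x, y)(u)` and `w ∈ DS₂(y, z)(v)`. -/
def TangentProductCondition {E F G : Type*} [NormedAddCommGroup E] [InnerProductSpace ℝ E]
    [NormedAddCommGroup F] [InnerProductSpace ℝ F] [NormedAddCommGroup G] [InnerProductSpace ℝ G]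
    (S₁ : E → Set F) (S₂ : F → Set G) (x : E) (y : F) (z : G) : Prop :=
  ∀ (u : E) (v : F) (w : G),
    pair (pair u v) (pair v w) ∈
        tangentCone (setProd (gph S₁) (gph S₂)) (pair (pair x y) (pair y z)) ↔
      v ∈ graphicalDeriv S₁ x y u ∧ w ∈ graphicalDeriv S₂ y z v

end VariationalAnalysis

open VariationalAnalysis

/-! Since `dom Ξ = gph S`, every statement about `S` concerns sequences in `gph S` together with a
choice of intermediate points `yₖ ∈ Ξ(xₖ, zₖ)`.

Primal side: inner calmness* gives `‖yₖ - y‖ = O(tₖ)`, so the quotients `(yₖ - y) / tₖ` subconverge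
to some `v`, and a tangent `(u, w)` to `gph S` splits into tangents `(u, v)` and `(v, w)`
(`exists_subseq_intermediate_direction`). Polarity turns this into the lower estimate for the
regular coderivative. Conversely, calmness of `M` repairs decoupled points with gap `o(tₖ)` at cost
`o(tₖ)`.

Dual side: calmness makes `‖y₁ - y₂‖` an exact penalty. The Fréchet inequality for a regular normal
`(x*, -z*)` to `gph S` persists for unrelated points `(x₁, y₁) ∈ gph S₁` and `(y₂, z₂) ∈ gph S₂` up
to a multiple of `‖y₁ - y₂‖` (`exists_penalty_bound`). Minimising a smoothed penalised objective
over a compact piece of `gph S₁ × gph S₂` and applying Fermat's rule in each factor gives regular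
normals to the two graphs near the base point; the gradient of the penalty is the common multiplier
`y*` (`exists_regularNormal_split`). Its bound depends only on the calmness constant and the size of
the normal, so multipliers subconverge (`exists_limit_split`). The coderivative estimates differ
only in how the base points approach the limit and how small the errors are taken. -/

namespace VariationalAnalysis

/-! ### Smoothing of the Euclidean norm -/

section SmoothNorm

variable {E : Type*} [NormedAddCommGroup E]

/-- A differentiable approximation of the norm. -/
noncomputable def smoothNorm (δ : ℝ) (v : E) : ℝ := √(‖v‖ ^ 2 + δ ^ 2)

lemma norm_le_smoothNorm (δ : ℝ) (v : E) : ‖v‖ ≤ smoothNorm δ v :=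
  Real.le_sqrt_of_sq_le (by nlinarith [sq_nonneg δ])

lemma smoothNorm_zero {δ : ℝ} (hδ : 0 ≤ δ) : smoothNorm δ (0 : E) = δ := by
  simp [smoothNorm, Real.sqrt_sq hδ]

lemma smoothNorm_pos {δ : ℝ} (hδ : 0 < δ) (v : E) : 0 < smoothNorm δ v :=
  Real.sqrt_pos.2 (by positivity)

lemma smoothNorm_sub_comm (δ : ℝ) (v w : E) : smoothNorm δ (v - w) = smoothNorm δ (w - v) := by
  rw [smoothNorm, smoothNorm, norm_sub_rev]

lemma continuous_smoothNorm (δ : ℝ) : Continuous (smoothNorm δ : E → ℝ) := by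
  unfold smoothNorm
  fun_prop

end SmoothNorm

/-! ### Fréchet inequality, Fermat's rule and directional convergence -/

section Cones

variable {E : Type*} [NormedAddCommGroup E] [InnerProductSpace ℝ E]

lemma zero_mem_tangentCone {Ω : Set E} {z : E} (hz : z ∈ Ω) : 0 ∈ tangentCone Ω z :=
  ⟨hz, fun k => 1 / ((k : ℝ) + 1), fun _ => 0, fun k => by positivity,
    tendsto_one_div_add_atTop_nhds_zero_nat, tendsto_const_nhds, fun k => by simpa using hz⟩

lemma smul_mem_tangentCone {Ω : Set E} {z w : E} (hw : w ∈ tangentCone Ω z) {c : ℝ} (hc : 0 < c) :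
    c • w ∈ tangentCone Ω z := by
  obtain ⟨hz, t, ws, ht, ht0, hws, hmem⟩ := hw
  refine ⟨hz, fun k => t k / c, fun k => c • ws k, fun k => div_pos (ht k) hc, ?_,
    hws.const_smul c, fun k => ?_⟩
  · simpa using ht0.div_const c
  · rw [smul_smul, div_mul_cancel₀ _ hc.ne']
    exact hmem k

/-- A regular normal satisfies the Fréchet inequality up to any positive tolerance. -/
lemma eventually_inner_le_of_mem_regularNormal [FiniteDimensional ℝ E] {Ω : Set E} {z n : E}
    (hn : n ∈ regularNormal Ω z) {ε : ℝ} (hε : 0 < ε) :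
    ∀ᶠ z' in 𝓝 z, z' ∈ Ω → inner ℝ n (z' - z) ≤ ε * ‖z' - z‖ := by
  by_contra hcon
  rw [not_eventually] at hcon
  obtain ⟨zs, hzs, hbad⟩ := exists_seq_forall_of_frequently hcon
  simp only [Classical.not_imp, not_le] at hbad
  have hne : ∀ k, 0 < ‖zs k - z‖ := by
    intro k
    rw [norm_pos_iff]
    intro h0
    have := (hbad k).2
    rw [h0] at this
    simp at this
  -- Normalised violating steps subconverge to a tangent unit vector `w` with `⟨n, w⟩ ≥ ε`,
  -- contradicting polarity.
  set ws : ℕ → E := fun k => ‖zs k - z‖⁻¹ • (zs k - z) with hws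
  have hws1 : ∀ k, ws k ∈ Metric.sphere (0 : E) 1 := by
    intro k
    simp [hws, norm_smul, inv_mul_cancel₀ (hne k).ne']
  obtain ⟨w, -, φ, hφ, hlim⟩ := (isCompact_sphere (0 : E) 1).tendsto_subseq hws1
  have ht0 : Tendsto (fun k => ‖zs (φ k) - z‖) atTop (𝓝 0) := by
    have := ((tendsto_iff_norm_sub_tendsto_zero).1 hzs).comp hφ.tendsto_atTop
    exact this
  have hwT : w ∈ tangentCone Ω z := by
    refine ⟨hn.1, fun k => ‖zs (φ k) - z‖, ws ∘ φ, fun k => hne _, ht0, hlim, fun k => ?_⟩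
    simp only [hws, Function.comp, smul_smul, mul_inv_cancel₀ (hne _).ne', one_smul,
      add_sub_cancel]
    exact (hbad _).1
  have hle := hn.2 w hwT
  have hge : ε ≤ inner ℝ n w := by
    refine ge_of_tendsto (tendsto_const_nhds.inner hlim) (Eventually.of_forall fun k => ?_)
    simp only [hws, Function.comp, inner_smul_right]
    have h2 := (hbad (φ k)).2
    rw [inv_mul_eq_div, le_div_iff₀ (hne _)]
    exact h2.le
  linarith

/-- Fermat's rule: at a local minimiser on `Ω` the negative gradient is a regular normal. -/
lemma neg_gradient_mem_regularNormal {Ω : Set E} {z n : E} {f : E → ℝ} (hz : z ∈ Ω)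
    (hmin : IsLocalMinOn f Ω z) (hf : HasFDerivAt f (innerSL ℝ n) z) :
    -n ∈ regularNormal Ω z := by
  refine ⟨hz, ?_⟩
  rintro w ⟨-, t, ws, ht, ht0, hws, hmem⟩
  have hd0 : Tendsto (fun k => t k • ws k) atTop (𝓝 0) := by
    simpa using ht0.smul hws
  have hcd : Tendsto (fun k => (t k)⁻¹ • (t k • ws k)) atTop (𝓝 w) := by
    refine hws.congr fun k => ?_
    rw [smul_smul, inv_mul_cancel₀ (ht k).ne', one_smul]
  have hl := (hf.hasFDerivWithinAt (s := Ω)).lim hd0 (Eventually.of_forall hmem) hcd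
  have htend : Tendsto (fun k => z + t k • ws k) atTop (𝓝[Ω] z) := by
    refine tendsto_nhdsWithin_iff.2 ⟨?_, Eventually.of_forall hmem⟩
    simpa using tendsto_const_nhds.add hd0
  have h0 : 0 ≤ innerSL ℝ n w := by
    refine ge_of_tendsto hl ((htend.eventually hmin).mono fun k hk => ?_)
    exact smul_nonneg (inv_nonneg.2 (ht k).le) (sub_nonneg.2 hk)
  rw [inner_neg_left]
  simpa using h0

/-- The gradient of `smoothNorm δ`. -/
noncomputable def smoothNormGrad (δ : ℝ) (v : E) : E := (smoothNorm δ v)⁻¹ • v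

lemma norm_smoothNormGrad_le {δ : ℝ} (hδ : 0 < δ) (v : E) : ‖smoothNormGrad δ v‖ ≤ 1 := by
  have h := smoothNorm_pos hδ v
  rw [smoothNormGrad, norm_smul, norm_inv, Real.norm_of_nonneg h.le, inv_mul_eq_div,
    div_le_one h]
  exact norm_le_smoothNorm δ v

lemma smoothNormGrad_sub_comm (δ : ℝ) (v w : E) :
    smoothNormGrad δ (v - w) = -smoothNormGrad δ (w - v) := by
  rw [smoothNormGrad, smoothNormGrad, smoothNorm_sub_comm, ← smul_neg, neg_sub]

lemma hasFDerivAt_smoothNorm_sub {δ : ℝ} (hδ : 0 < δ) (c v : E) :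
    HasFDerivAt (fun v => smoothNorm δ (v - c)) (innerSL ℝ (smoothNormGrad δ (v - c))) v := by
  have h1 : HasFDerivAt (fun v : E => ‖v - c‖ ^ 2 + δ ^ 2)
      (2 • (innerSL ℝ (v - c)).comp (ContinuousLinearMap.id ℝ E)) v :=
    (((hasFDerivAt_id v).sub_const c).norm_sq).add_const _
  have hne : ‖v - c‖ ^ 2 + δ ^ 2 ≠ 0 := by positivity
  refine (h1.sqrt hne).congr_fderiv ?_
  ext w
  have hs : √(‖v - c‖ ^ 2 + δ ^ 2) ≠ 0 := (smoothNorm_pos hδ (v - c)).ne'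
  simp [smoothNormGrad, smoothNorm]
  field_simp

lemma hasFDerivAt_inner_add_smoothNorm {δ : ℝ} (hδ : 0 < δ) (n c v : E) (ε : ℝ) :
    HasFDerivAt (fun v => inner ℝ n (v - c) + ε * smoothNorm δ (v - c))
      (innerSL ℝ (n + ε • smoothNormGrad δ (v - c))) v := by
  have h1 : HasFDerivAt (fun v => inner ℝ n (v - c)) (innerSL ℝ n) v := by
    exact (innerSL ℝ n).hasFDerivAt.comp v ((hasFDerivAt_id v).sub_const c)
  refine (h1.add ((hasFDerivAt_smoothNorm_sub hδ c v).const_mul ε)).congr_fderiv ?_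
  rw [map_add, map_smul]

/-- A sequence within `o(t)` of one that converges from a direction, converges from the same
direction, with the same step lengths. -/
lemma exists_direction_of_near {z w : E} {t r : ℕ → ℝ} {ws a : ℕ → E} (ht : ∀ k, 0 < t k)
    (hws : Tendsto ws atTop (𝓝 w)) (hr : Tendsto r atTop (𝓝 0))
    (ha : ∀ k, ‖a k - (z + t k • ws k)‖ ≤ t k * r k) :
    ∃ ws' : ℕ → E, Tendsto ws' atTop (𝓝 w) ∧ ∀ k, a k = z + t k • ws' k := by
  refine ⟨fun k => (t k)⁻¹ • (a k - z), ?_, fun k => ?_⟩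
  · refine tendsto_of_tendsto_of_dist hws (squeeze_zero (fun _ => dist_nonneg) (fun k => ?_) hr)
    have heq : ws k - (t k)⁻¹ • (a k - z) = -((t k)⁻¹ • (a k - (z + t k • ws k))) := by
      rw [← sub_sub, smul_sub _ (a k - z), smul_smul, inv_mul_cancel₀ (ht k).ne', one_smul]
      abel
    rw [dist_eq_norm, heq, norm_neg, norm_smul, norm_inv, Real.norm_of_nonneg (ht k).le,
      inv_mul_le_iff₀ (ht k)]
    exact ha k
  · rw [smul_smul, mul_inv_cancel₀ (ht k).ne', one_smul, add_sub_cancel]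

lemma mem_dirLimitingNormal_of_near {Ω : Set E} {z w n : E} (hz : z ∈ Ω) {t r : ℕ → ℝ}
    {ws a ns : ℕ → E} (ht : ∀ k, 0 < t k) (ht0 : Tendsto t atTop (𝓝 0))
    (hws : Tendsto ws atTop (𝓝 w)) (hr : Tendsto r atTop (𝓝 0))
    (ha : ∀ k, ‖a k - (z + t k • ws k)‖ ≤ t k * r k) (hns : Tendsto ns atTop (𝓝 n))
    (hmem : ∀ k, ns k ∈ regularNormal Ω (a k)) : n ∈ dirLimitingNormal Ω z w := by
  obtain ⟨ws', hws', heq⟩ := exists_direction_of_near ht hws hr ha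
  exact ⟨hz, t, ws', ns, ht, ht0, hws', hns, fun k => heq k ▸ hmem k⟩

end Cones

/-! ### Euclidean products: norms and limits -/

section NormedProducts

variable {E F : Type*} [NormedAddCommGroup E] [NormedAddCommGroup F]

lemma norm_le_fst_add_snd (p : EProd E F) : ‖p‖ ≤ ‖p.fst‖ + ‖p.snd‖ := by
  rw [WithLp.prod_norm_eq_of_L2, Real.sqrt_le_left (by positivity)]
  nlinarith [norm_nonneg p.fst, norm_nonneg p.snd]

lemma norm_pair_sub_le (a a' : E) (b b' : F) :
    ‖pair a b - pair a' b'‖ ≤ ‖a - a'‖ + ‖b - b'‖ :=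
  norm_le_fst_add_snd _

lemma norm_fst_sub_le (a a' : E) (b b' : F) : ‖a - a'‖ ≤ ‖pair a b - pair a' b'‖ :=
  WithLp.norm_fst_le (p := 2) (x := pair a b - pair a' b')

lemma norm_snd_sub_le (a a' : E) (b b' : F) : ‖b - b'‖ ≤ ‖pair a b - pair a' b'‖ :=
  WithLp.norm_snd_le (p := 2) (x := pair a b - pair a' b')

lemma Tendsto.pair {α : Type*} {L : Filter α} {f : α → E} {g : α → F} {a : E} {b : F}
    (hf : Tendsto f L (𝓝 a)) (hg : Tendsto g L (𝓝 b)) :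
    Tendsto (fun k => VariationalAnalysis.pair (f k) (g k)) L (𝓝 (VariationalAnalysis.pair a b)) :=
  (WithLp.prod_continuous_toLp 2 E F).continuousAt.tendsto.comp (hf.prodMk_nhds hg)

lemma Tendsto.fst {α : Type*} {L : Filter α} {f : α → EProd E F} {p : EProd E F}
    (hf : Tendsto f L (𝓝 p)) : Tendsto (fun k => (f k).fst) L (𝓝 p.fst) :=
  (WithLp.continuous_fst 2 E F).continuousAt.tendsto.comp hf

lemma Tendsto.snd {α : Type*} {L : Filter α} {f : α → EProd E F} {p : EProd E F}
    (hf : Tendsto f L (𝓝 p)) : Tendsto (fun k => (f k).snd) L (𝓝 p.snd) :=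
  (WithLp.continuous_snd 2 E F).continuousAt.tendsto.comp hf

end NormedProducts

/-! ### Fermat's rule on graphs -/

section Products

variable {E F : Type*} [NormedAddCommGroup E] [InnerProductSpace ℝ E]
  [NormedAddCommGroup F] [InnerProductSpace ℝ F]

lemma inner_pair (a a' : E) (b b' : F) :
    inner ℝ (pair a b) (pair a' b') = inner ℝ a a' + inner ℝ b b' :=
  WithLp.prod_inner_apply _ _

/-- Fermat's rule on a graph for an objective that separates the two variables. -/
lemma neg_gradient_mem_regularNormal_gph {M : E → Set F} {y : E} {x : F} (hx : x ∈ M y)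
    {g : E → ℝ} {h : F → ℝ} {a : E} {b : F}
    (hmin : IsLocalMinOn (fun p : EProd E F => g p.fst + h p.snd) (gph M) (pair y x))
    (hg : HasFDerivAt g (innerSL ℝ a) y) (hh : HasFDerivAt h (innerSL ℝ b) x) :
    pair (-a) (-b) ∈ regularNormal (gph M) (pair y x) := by
  have hneg : pair (-a) (-b) = -pair a b := rfl
  rw [hneg]
  refine neg_gradient_mem_regularNormal hx hmin ?_
  have h1 : HasFDerivAt (fun p : EProd E F => g p.fst)
      ((innerSL ℝ a).comp (WithLp.fstL 2 ℝ E F)) (pair y x) :=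
    HasFDerivAt.comp (pair y x) (f := fun p : EProd E F => p.fst) hg
      (WithLp.fstL 2 ℝ E F).hasFDerivAt
  have h2 : HasFDerivAt (fun p : EProd E F => h p.snd)
      ((innerSL ℝ b).comp (WithLp.sndL 2 ℝ E F)) (pair y x) :=
    HasFDerivAt.comp (pair y x) (f := fun p : EProd E F => p.snd) hh
      (WithLp.sndL 2 ℝ E F).hasFDerivAt
  refine (h1.add h2).congr_fderiv ?_
  ext p
  symm
  exact WithLp.prod_inner_apply (pair a b) p

end Products

/-! ### Calmness on neighbourhoods -/

section Calmness

variable {E F : Type*} [NormedAddCommGroup E] [NormedAddCommGroup F]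

/-- Calmness of `M` at `(y, x)` with constant `κ`, stated on a neighbourhood of `x`. -/
def CalmNear (M : E → Set F) (κ : ℝ) (y : E) (x : F) : Prop :=
  ∀ᶠ x' in 𝓝 x, ∀ y', x' ∈ M y' → ∃ x'' ∈ M y, ‖x' - x''‖ ≤ κ * ‖y' - y‖

/-- A sequence of points violating the estimate with the given `κ` would contradict calmness. On an
open set of points the same `κ` then also serves at nearby base points. -/
lemma CalmAt.exists_calmNear {M : E → Set F} {y : E} {x : F} (h : CalmAt M y x) :
    ∃ κ : ℝ, 0 < κ ∧ CalmNear M κ y x := by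
  obtain ⟨κ, hκ, h⟩ := h
  refine ⟨κ, hκ, ?_⟩
  by_contra hcon
  rw [CalmNear, not_eventually] at hcon
  obtain ⟨xs, hxs, hbad⟩ := exists_seq_forall_of_frequently hcon
  push Not at hbad
  choose ys hys hbad using hbad
  obtain ⟨xs', hmem, hle⟩ := h xs ys hxs hys
  obtain ⟨k, hk⟩ := hle.exists
  exact absurd hk (not_le.2 (hbad k _ (hmem k)))

/-- If the estimate failed near `x + tₖ uₖ` for infinitely many `k`, violating points could be
picked within `o(tₖ)` of these; they too converge to `x` from `u`, against directional calmness. The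
size of the neighbourhoods is not controlled, only `κ` is uniform. -/
lemma CalmAtDir.exists_calmNear [InnerProductSpace ℝ F] {M : E → Set F} {y : E} {x u : F} (h : CalmAtDir M y x u) :
    ∃ κ : ℝ, 0 < κ ∧ ∀ (t : ℕ → ℝ) (us : ℕ → F), (∀ k, 0 < t k) → Tendsto t atTop (𝓝 0) →
      Tendsto us atTop (𝓝 u) → ∀ᶠ k in atTop, CalmNear M κ y (x + t k • us k) := by
  obtain ⟨κ, hκ, h⟩ := h
  refine ⟨κ, hκ, fun t us ht ht0 hus => ?_⟩
  by_contra hcon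
  rw [not_eventually] at hcon
  obtain ⟨φ, hφ, hbad⟩ := extraction_of_frequently_atTop hcon
  have hex : ∀ k : ℕ, ∃ x' : F, ‖x' - (x + t (φ k) • us (φ k))‖ < t (φ k) * (1 / ((k : ℝ) + 1)) ∧
      ∃ y', x' ∈ M y' ∧ ∀ x'' ∈ M y, κ * ‖y' - y‖ < ‖x' - x''‖ := by
    intro k
    have h1 := hbad k
    rw [CalmNear, not_eventually] at h1
    have hpos : 0 < t (φ k) * (1 / ((k : ℝ) + 1)) := mul_pos (ht _) (by positivity)
    obtain ⟨x', hx', hd⟩ := (h1.and_eventually (Metric.ball_mem_nhds _ hpos)).exists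
    push Not at hx'
    exact ⟨x', by simpa [dist_eq_norm] using hd, hx'⟩
  choose xs hclose ys hys hfar using hex
  have hfrom : ConvergesFrom xs x u := by
    obtain ⟨us', hus', heq⟩ := exists_direction_of_near (fun k => ht (φ k))
      (hus.comp hφ.tendsto_atTop) tendsto_one_div_add_atTop_nhds_zero_nat (fun k => (hclose k).le)
    exact ⟨t ∘ φ, us', fun k => ht _, ht0.comp hφ.tendsto_atTop, hus', heq⟩
  obtain ⟨xs', hmem, hle⟩ := h xs ys hfrom hys
  obtain ⟨k, hk⟩ := hle.exists
  exact absurd hk (not_le.2 (hfar k _ (hmem k)))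

end Calmness

/-! ### Exact penalisation and splitting of regular normals -/

section Penalty

variable {E F G : Type*} [NormedAddCommGroup E] [InnerProductSpace ℝ E] [FiniteDimensional ℝ E]
  [NormedAddCommGroup F]
  [NormedAddCommGroup G] [InnerProductSpace ℝ G] [FiniteDimensional ℝ G]
  {S₁ : E → Set F} {S₂ : F → Set G} {x : E} {y : F} {z : G} {κ : ℝ} {xs : E} {zs : G} {B : ℝ}

/-- Exact penalisation: the Fréchet inequality for a regular normal to the graph of a composition,
carried over by calmness to decoupled points of the two graphs. -/
lemma exists_penalty_bound (hκ : 0 < κ)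
    (hcalm : CalmNear (perturbation S₁ S₂) κ (pair 0 0) (pair x (pair z y)))
    (hn : pair xs (-zs) ∈ regularNormal (gph (compose S₂ S₁)) (pair x z))
    (hB : ‖xs‖ + ‖zs‖ ≤ B) {η : ℝ} (hη : 0 < η) (hη1 : 2 * η ≤ 1) :
    ∃ ρ > 0, ∀ x₁ y₁ y₂ z₂, y₁ ∈ S₁ x₁ → z₂ ∈ S₂ y₂ → ‖x₁ - x‖ < ρ → ‖z₂ - z‖ < ρ →
      ‖y₂ - y‖ < ρ → ‖y₁ - y₂‖ < ρ →
      inner ℝ xs (x₁ - x) - inner ℝ zs (z₂ - z) ≤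
        η * (‖x₁ - x‖ + ‖z₂ - z‖) + (B + 1) * κ * ‖y₁ - y₂‖ := by
  obtain ⟨r, hr, hcalm⟩ := Metric.eventually_nhds_iff.1 hcalm
  obtain ⟨d, hd, hfre⟩ :=
    Metric.eventually_nhds_iff.1 (eventually_inner_le_of_mem_regularNormal hn hη)
  -- The bound `r / 3` keeps `(x₁, z₂, y₂)` in the calmness neighbourhood; `d / (2 + 2κ)` keeps the
  -- repaired point, shifted by at most `κ‖y₁ - y₂‖` per component, in the Fréchet neighbourhood.
  refine ⟨min (r / 3) (d / (2 + 2 * κ)), by positivity, ?_⟩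
  intro x₁ y₁ y₂ z₂ h₁ h₂ hx hz hy hp
  rw [lt_min_iff] at hx hz hy hp
  have hs : dist (pair x₁ (pair z₂ y₂)) (pair x (pair z y)) < r := by
    rw [dist_eq_norm]
    have := norm_pair_sub_le x₁ x (pair z₂ y₂) (pair z y)
    have := norm_pair_sub_le z₂ z y₂ y
    linarith [hx.1, hz.1, hy.1]
  -- Only the first constraint is perturbed: `y₂ + (y₁ - y₂) = y₁ ∈ S₁ x₁`.
  have hmem : pair x₁ (pair z₂ y₂) ∈ perturbation S₁ S₂ (pair (y₁ - y₂) 0) := by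
    refine ⟨?_, ?_⟩
    · simpa using h₁
    · simpa using h₂
  obtain ⟨s, hsM, hsle⟩ := hcalm hs _ hmem
  have hpn : ‖pair (y₁ - y₂) (0 : G) - pair 0 0‖ ≤ ‖y₁ - y₂‖ := by
    simpa using norm_pair_sub_le (y₁ - y₂) 0 (0 : G) 0
  have hsle' : ‖pair x₁ (pair z₂ y₂) - s‖ ≤ κ * ‖y₁ - y₂‖ := hsle.trans (by gcongr)
  have hxs : ‖x₁ - s.fst‖ ≤ κ * ‖y₁ - y₂‖ :=
    (norm_fst_sub_le x₁ s.fst (pair z₂ y₂) s.snd).trans hsle'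
  have hzs : ‖z₂ - s.snd.fst‖ ≤ κ * ‖y₁ - y₂‖ :=
    (norm_fst_sub_le z₂ s.snd.fst y₂ s.snd.snd).trans
      ((norm_snd_sub_le x₁ s.fst (pair z₂ y₂) s.snd).trans hsle')
  have hsS : pair s.fst s.snd.fst ∈ gph (compose S₂ S₁) := by
    obtain ⟨ha, hb⟩ := hsM
    simp only [WithLp.toLp_fst, WithLp.toLp_snd, add_zero] at ha hb
    exact Set.mem_biUnion ha hb
  have hx' : ‖s.fst - x‖ ≤ ‖x₁ - x‖ + κ * ‖y₁ - y₂‖ := by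
    have := norm_sub_le_norm_sub_add_norm_sub s.fst x₁ x
    rw [norm_sub_rev s.fst x₁] at this
    linarith
  have hz' : ‖s.snd.fst - z‖ ≤ ‖z₂ - z‖ + κ * ‖y₁ - y₂‖ := by
    have := norm_sub_le_norm_sub_add_norm_sub s.snd.fst z₂ z
    rw [norm_sub_rev s.snd.fst z₂] at this
    linarith
  have hle := norm_pair_sub_le s.fst x s.snd.fst z
  have hdist : dist (pair s.fst s.snd.fst) (pair x z) < d := by
    rw [dist_eq_norm]
    have h1 : κ * ‖y₁ - y₂‖ ≤ κ * (d / (2 + 2 * κ)) := by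
      gcongr
      exact hp.2.le
    have h2 : (2 + 2 * κ) * (d / (2 + 2 * κ)) = d := by field_simp
    nlinarith [hx.2, hz.2]
  have hin := hfre hdist hsS
  have hsplit : inner ℝ (pair xs (-zs)) (pair s.fst s.snd.fst - pair x z)
      = inner ℝ xs (s.fst - x) - inner ℝ zs (s.snd.fst - z) := by
    rw [show pair s.fst s.snd.fst - pair x z = pair (s.fst - x) (s.snd.fst - z) from rfl,
      inner_pair, inner_neg_left, ← sub_eq_add_neg]
  rw [hsplit] at hin
  have hi1 : inner ℝ xs (x₁ - x) - inner ℝ xs (s.fst - x) ≤ ‖xs‖ * (κ * ‖y₁ - y₂‖) := by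
    rw [← inner_sub_right, sub_sub_sub_cancel_right]
    exact (real_inner_le_norm _ _).trans (by gcongr)
  have hi2 : inner ℝ zs (s.snd.fst - z) - inner ℝ zs (z₂ - z) ≤ ‖zs‖ * (κ * ‖y₁ - y₂‖) := by
    rw [← inner_sub_right, sub_sub_sub_cancel_right]
    refine (real_inner_le_norm _ _).trans ?_
    rw [norm_sub_rev]
    gcongr
  have hP : 0 ≤ κ * ‖y₁ - y₂‖ := by positivity
  have h3 : (‖xs‖ + ‖zs‖) * (κ * ‖y₁ - y₂‖) ≤ B * (κ * ‖y₁ - y₂‖) := by gcongr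
  have h4 : η * ‖pair s.fst s.snd.fst - pair x z‖ ≤
      η * (‖x₁ - x‖ + ‖z₂ - z‖ + 2 * (κ * ‖y₁ - y₂‖)) := by
    gcongr
    linarith
  -- Cauchy–Schwarz for the repair costs `Bκ‖y₁ - y₂‖`, and the tolerance adds `2ηκ‖y₁ - y₂‖ ≤ κ‖y₁
  -- - y₂‖`; hence the factor `B + 1`.
  nlinarith [mul_le_mul_of_nonneg_right hη1 hP]

/-- Near a point where the perturbation mapping is calm, a regular normal to the graph of a
composition splits, up to an arbitrarily small error, into regular normals to the two graphs,
with a bound for the intermediate vector that depends only on the calmness constant. -/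
lemma exists_regularNormal_split [InnerProductSpace ℝ F] [FiniteDimensional ℝ F]
    (hS₁ : IsClosed (gph S₁)) (hS₂ : IsClosed (gph S₂))
    (hy₁ : y ∈ S₁ x) (hy₂ : z ∈ S₂ y) (hκ : 0 < κ)
    (hcalm : CalmNear (perturbation S₁ S₂) κ (pair 0 0) (pair x (pair z y)))
    (hn : pair xs (-zs) ∈ regularNormal (gph (compose S₂ S₁)) (pair x z))
    (hB : ‖xs‖ + ‖zs‖ ≤ B) {ε : ℝ} (hε : 0 < ε) (hε1 : ε ≤ 1) :
    ∃ (a : EProd E F) (b : EProd F G) (e₁ : E) (ys e₂ : F) (e₃ : G),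
      ‖a - pair x y‖ ≤ ε ∧ ‖b - pair y z‖ ≤ ε ∧ ‖e₁‖ ≤ ε ∧ ‖e₂‖ ≤ ε ∧ ‖e₃‖ ≤ ε ∧
      ‖ys‖ ≤ (B + 1) * κ + 1 ∧ pair (xs - e₁) (-ys) ∈ regularNormal (gph S₁) a ∧
      pair (ys - e₂) (-(zs + e₃)) ∈ regularNormal (gph S₂) b := by
  obtain ⟨ρ, hρ, hpen⟩ :=
    exists_penalty_bound hκ hcalm hn hB (half_pos hε) (by linarith : 2 * (ε / 2) ≤ 1)
  have hB0 : 0 ≤ B := (by positivity : 0 ≤ ‖xs‖ + ‖zs‖).trans hB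
  -- The excess of 1 over the exact penalty constant makes the gap `‖a.snd - b.fst‖` itself small at
  -- the minimiser.
  obtain ⟨L, hL⟩ : ∃ L, L = (B + 1) * κ + 1 := ⟨_, rfl⟩
  have hL0 : 0 < L := by rw [hL]; positivity
  -- The minimiser will be within `3m` of the base pair: at most `ε`, and less than the ball radius
  -- `ρ / 4`, so that it is a local minimiser on the graphs.
  obtain ⟨m, hm, hm0⟩ : ∃ m, m = min (ρ / 16) (ε / 3) ∧ 0 < m := ⟨_, rfl, by positivity⟩
  have hmρ : m ≤ ρ / 16 := hm ▸ min_le_left _ _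
  have hmε : m ≤ ε / 3 := hm ▸ min_le_right _ _
  -- At the base pair the objective equals `(3ε + L)δ`, pure smoothing error; `δ` makes it `(ε / 2)
  -- m`.
  obtain ⟨δ, hδ, hδ0⟩ : ∃ δ, (3 * ε + L) * δ = ε / 2 * m ∧ 0 < δ :=
    ⟨ε / 2 * m / (3 * ε + L), by field_simp, by positivity⟩
  -- The Fréchet inequality has tolerance `ε / 2`, so weight `ε` leaves a surplus. It says nothing
  -- about the intermediate variable, which needs its own `ε`-term.
  set Φ : EProd E F × EProd F G → ℝ := fun p =>
    (inner ℝ (-xs) (p.1.fst - x) + ε * smoothNorm δ (p.1.fst - x)) +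
    (inner ℝ zs (p.2.snd - z) + ε * smoothNorm δ (p.2.snd - z)) +
    ε * smoothNorm δ (p.2.fst - y) + L * smoothNorm δ (p.1.snd - p.2.fst) with hΦ
  have hΦc : Continuous Φ := by
    have hsE := continuous_smoothNorm (E := E) δ
    have hsF := continuous_smoothNorm (E := F) δ
    have hsG := continuous_smoothNorm (E := G) δ
    have c1 := WithLp.continuous_fst 2 E F
    have c2 := WithLp.continuous_snd 2 E F
    have c3 := WithLp.continuous_fst 2 F G
    have c4 := WithLp.continuous_snd 2 F G
    fun_prop
  set K₁ := gph S₁ ∩ Metric.closedBall (pair x y) (ρ / 4) with hK₁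
  set K₂ := gph S₂ ∩ Metric.closedBall (pair y z) (ρ / 4) with hK₂
  have : ProperSpace (EProd E F) := FiniteDimensional.proper ℝ _
  have : ProperSpace (EProd F G) := FiniteDimensional.proper ℝ _
  have hK : IsCompact (K₁ ×ˢ K₂) :=
    ((isCompact_closedBall _ _).inter_left hS₁).prod ((isCompact_closedBall _ _).inter_left hS₂)
  have hρ4 : 0 ≤ ρ / 4 := by positivity
  have hbase : (pair x y, pair y z) ∈ K₁ ×ˢ K₂ :=
    ⟨⟨hy₁, Metric.mem_closedBall_self hρ4⟩, ⟨hy₂, Metric.mem_closedBall_self hρ4⟩⟩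
  obtain ⟨⟨a, b⟩, ⟨⟨ha, haρ⟩, hb, hbρ⟩, hmin⟩ := hK.exists_isMinOn ⟨_, hbase⟩ hΦc.continuousOn
  simp only [Metric.mem_closedBall, dist_eq_norm] at haρ hbρ
  have hX := (norm_fst_sub_le a.fst x a.snd y).trans haρ
  have hY₁ := (norm_snd_sub_le a.fst x a.snd y).trans haρ
  have hY₂ := (norm_fst_sub_le b.fst y b.snd z).trans hbρ
  have hZ := (norm_snd_sub_le b.fst y b.snd z).trans hbρ
  have hP : ‖a.snd - b.fst‖ ≤ ‖a.snd - y‖ + ‖b.fst - y‖ := by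
    rw [norm_sub_rev b.fst]
    exact norm_sub_le_norm_sub_add_norm_sub _ _ _
  have hp := hpen a.fst a.snd b.fst b.snd ha hb (by linarith) (by linarith) (by linarith)
    (by linarith)
  have hval : Φ (a, b) ≤ (3 * ε + L) * δ := by
    have h0 := hmin hbase
    have h1 : Φ (pair x y, pair y z) = (3 * ε + L) * δ := by
      simp only [hΦ, WithLp.toLp_fst, WithLp.toLp_snd, sub_self, inner_zero_right,
        smoothNorm_zero hδ0.le]
      ring
    exact h1 ▸ h0
  have hsum : ‖a.fst - x‖ + ‖b.snd - z‖ + ‖b.fst - y‖ + ‖a.snd - b.fst‖ ≤ m := by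
    have n1 := mul_le_mul_of_nonneg_left (norm_le_smoothNorm δ (a.fst - x)) hε.le
    have n2 := mul_le_mul_of_nonneg_left (norm_le_smoothNorm δ (b.snd - z)) hε.le
    have n3 := mul_le_mul_of_nonneg_left (norm_le_smoothNorm δ (b.fst - y)) hε.le
    have n4 := mul_le_mul_of_nonneg_left (norm_le_smoothNorm δ (a.snd - b.fst)) hL0.le
    have n5 : ε / 2 * ‖a.snd - b.fst‖ ≤ 1 * ‖a.snd - b.fst‖ := by
      gcongr
      linarith
    have n6 : 0 ≤ ε * ‖b.fst - y‖ := by positivity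
    have n7 : L * ‖a.snd - b.fst‖ = (B + 1) * κ * ‖a.snd - b.fst‖ + ‖a.snd - b.fst‖ := by
      rw [hL]; ring
    rw [hδ] at hval
    simp only [hΦ, inner_neg_left] at hval
    have : ε / 2 * (‖a.fst - x‖ + ‖b.snd - z‖ + ‖b.fst - y‖ + ‖a.snd - b.fst‖) ≤ ε / 2 * m := by
      linarith
    exact le_of_mul_le_mul_left this (half_pos hε)
  have hX0 := norm_nonneg (a.fst - x)
  have hZ0 := norm_nonneg (b.snd - z)
  have hY0 := norm_nonneg (b.fst - y)
  have hP0 := norm_nonneg (a.snd - b.fst)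
  have hya : ‖a.snd - y‖ ≤ ‖a.snd - b.fst‖ + ‖b.fst - y‖ :=
    norm_sub_le_norm_sub_add_norm_sub _ _ _
  have ha' : ‖a - pair x y‖ ≤ 3 * m :=
    (norm_pair_sub_le a.fst x a.snd y).trans (by linarith)
  have hb' : ‖b - pair y z‖ ≤ 3 * m :=
    (norm_pair_sub_le b.fst y b.snd z).trans (by linarith)
  -- With `b` frozen the objective separates in the two variables; the terms `inner ℝ 0 _` only fit
  -- it to `hasFDerivAt_inner_add_smoothNorm`.
  have hmina : IsLocalMinOn (fun p : EProd E F =>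
      (inner ℝ (-xs) (p.fst - x) + ε * smoothNorm δ (p.fst - x)) +
      (inner ℝ 0 (p.snd - b.fst) + L * smoothNorm δ (p.snd - b.fst))) (gph S₁)
      (pair a.fst a.snd) := by
    have hball : Metric.ball (pair x y) (ρ / 4) ∈ 𝓝 a :=
      Metric.isOpen_ball.mem_nhds (by rw [Metric.mem_ball, dist_eq_norm]; linarith)
    filter_upwards [mem_nhdsWithin_of_mem_nhds hball, self_mem_nhdsWithin] with p hp1 hp2
    have := hmin (show (p, b) ∈ K₁ ×ˢ K₂ from
      ⟨⟨hp2, Metric.ball_subset_closedBall hp1⟩, hb, by simpa [dist_eq_norm] using hbρ⟩)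
    simp only [hΦ, Set.mem_ofPred_eq] at this
    simp only [inner_zero_left, WithLp.toLp_fst, WithLp.toLp_snd]
    linarith
  have hminb : IsLocalMinOn (fun p : EProd F G =>
      ((inner ℝ 0 (p.fst - y) + ε * smoothNorm δ (p.fst - y)) +
        (inner ℝ 0 (p.fst - a.snd) + L * smoothNorm δ (p.fst - a.snd))) +
      (inner ℝ zs (p.snd - z) + ε * smoothNorm δ (p.snd - z))) (gph S₂)
      (pair b.fst b.snd) := by
    have hball : Metric.ball (pair y z) (ρ / 4) ∈ 𝓝 b :=
      Metric.isOpen_ball.mem_nhds (by rw [Metric.mem_ball, dist_eq_norm]; linarith)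
    filter_upwards [mem_nhdsWithin_of_mem_nhds hball, self_mem_nhdsWithin] with p hp1 hp2
    have := hmin (show (a, p) ∈ K₁ ×ˢ K₂ from
      ⟨⟨ha, by simpa [dist_eq_norm] using haρ⟩, hp2, Metric.ball_subset_closedBall hp1⟩)
    simp only [hΦ, Set.mem_ofPred_eq] at this
    rw [smoothNorm_sub_comm δ a.snd, smoothNorm_sub_comm δ a.snd] at this
    simp only [inner_zero_left, WithLp.toLp_fst, WithLp.toLp_snd]
    linarith
  have hna := neg_gradient_mem_regularNormal_gph (M := S₁) ha hmina
    (hasFDerivAt_inner_add_smoothNorm hδ0 (-xs) x _ ε)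
    (hasFDerivAt_inner_add_smoothNorm hδ0 0 b.fst _ L)
  have hdb := ((hasFDerivAt_inner_add_smoothNorm hδ0 0 y b.fst ε).add
    (hasFDerivAt_inner_add_smoothNorm hδ0 0 a.snd b.fst L))
  rw [← map_add] at hdb
  have hnb := neg_gradient_mem_regularNormal_gph (M := S₂) hb hminb hdb
    (hasFDerivAt_inner_add_smoothNorm hδ0 zs z _ ε)
  -- The penalty has opposite gradients in `a.snd` and `b.fst`, so one vector `ys` serves both
  -- graphs.
  refine ⟨a, b, ε • smoothNormGrad δ (a.fst - x), L • smoothNormGrad δ (a.snd - b.fst),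
    ε • smoothNormGrad δ (b.fst - y), ε • smoothNormGrad δ (b.snd - z), by linarith, by linarith,
    ?_, ?_, ?_, ?_, ?_, ?_⟩
  · rw [norm_smul, Real.norm_of_nonneg hε.le]
    exact mul_le_of_le_one_right hε.le (norm_smoothNormGrad_le hδ0 _)
  · rw [norm_smul, Real.norm_of_nonneg hε.le]
    exact mul_le_of_le_one_right hε.le (norm_smoothNormGrad_le hδ0 _)
  · rw [norm_smul, Real.norm_of_nonneg hε.le]
    exact mul_le_of_le_one_right hε.le (norm_smoothNormGrad_le hδ0 _)
  · rw [norm_smul, Real.norm_of_nonneg hL0.le, ← hL]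
    exact mul_le_of_le_one_right hL0.le (norm_smoothNormGrad_le hδ0 _)
  · rwa [neg_add, neg_neg, zero_add, ← sub_eq_add_neg] at hna
  · rw [smoothNormGrad_sub_comm δ b.fst a.snd, smul_neg] at hnb
    simp only [zero_add] at hnb
    rwa [neg_add (ε • _), neg_neg, neg_add_eq_sub] at hnb

end Penalty

/-! ### The intermediate mapping -/

section Intermediate

lemma dom_intermediate {E F G : Type*} (S₁ : E → Set F) (S₂ : F → Set G) :
    dom (intermediate S₁ S₂) = gph (compose S₂ S₁) := by
  ext p
  simp [dom, intermediate, gph, compose, inv, Set.Nonempty]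

variable {E F G : Type*} [NormedAddCommGroup E] [NormedAddCommGroup F] [NormedAddCommGroup G]
  {S₁ : E → Set F} {S₂ : F → Set G}

lemma mem_intermediate_of_tendsto (hS₁ : IsClosed (gph S₁)) (hS₂ : IsClosed (gph S₂))
    {ps : ℕ → EProd E G} {ys : ℕ → F} {p : EProd E G} {y : F} (hps : Tendsto ps atTop (𝓝 p))
    (hys : Tendsto ys atTop (𝓝 y)) (hmem : ∀ k, ys k ∈ intermediate S₁ S₂ (ps k)) :
    y ∈ intermediate S₁ S₂ p :=
  ⟨hS₁.mem_of_tendsto (Tendsto.pair (Tendsto.fst hps) hys)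
      (Eventually.of_forall fun k => (hmem k).1),
    hS₂.mem_of_tendsto (Tendsto.pair hys (Tendsto.snd hps))
      (Eventually.of_forall fun k => (hmem k).2)⟩

/-- A linear estimate for the intermediate points along a sequence converging from a direction
yields a limiting intermediate point, and a direction from which it is approached. -/
lemma exists_subseq_intermediate_direction [NormedSpace ℝ E] [NormedSpace ℝ G]
    [NormedSpace ℝ F] [FiniteDimensional ℝ F]
    (hS₁ : IsClosed (gph S₁)) (hS₂ : IsClosed (gph S₂))
    {p d : EProd E G} {y : F} {κ : ℝ} {t : ℕ → ℝ} {ds : ℕ → EProd E G} {ys : ℕ → F}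
    (ht : ∀ k, 0 < t k) (ht0 : Tendsto t atTop (𝓝 0)) (hds : Tendsto ds atTop (𝓝 d))
    (hmem : ∀ k, ys k ∈ intermediate S₁ S₂ (p + t k • ds k))
    (hle : ∀ k, ‖ys k - y‖ ≤ κ * ‖p + t k • ds k - p‖) :
    y ∈ intermediate S₁ S₂ p ∧ ∃ (v : F) (vs : ℕ → F) (φ : ℕ → ℕ), StrictMono φ ∧
      Tendsto vs atTop (𝓝 v) ∧ ∀ k, ys (φ k) = y + t (φ k) • vs k := by
  have hle' : ∀ k, ‖ys k - y‖ ≤ t k * (κ * ‖ds k‖) := by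
    intro k
    refine (hle k).trans_eq ?_
    rw [add_sub_cancel_left, norm_smul, Real.norm_of_nonneg (ht k).le]
    ring
  have hp : Tendsto (fun k => p + t k • ds k) atTop (𝓝 p) := by
    simpa using tendsto_const_nhds.add (ht0.smul hds)
  have hy : Tendsto ys atTop (𝓝 y) := by
    rw [tendsto_iff_norm_sub_tendsto_zero]
    refine squeeze_zero (fun _ => norm_nonneg _) hle' ?_
    simpa using ht0.mul (hds.norm.const_mul κ)
  refine ⟨mem_intermediate_of_tendsto hS₁ hS₂ hp hy hmem, ?_⟩
  obtain ⟨C, hC⟩ := (hds.norm.const_mul κ).bddAbove_range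
  have : ProperSpace F := FiniteDimensional.proper ℝ F
  -- The linear estimate bounds the difference quotients, so compactness yields `v`.
  have hbd : ∀ k, (t k)⁻¹ • (ys k - y) ∈ Metric.closedBall (0 : F) C := by
    intro k
    rw [mem_closedBall_zero_iff, norm_smul, norm_inv, Real.norm_of_nonneg (ht k).le,
      inv_mul_le_iff₀ (ht k)]
    exact (hle' k).trans (mul_le_mul_of_nonneg_left (hC ⟨k, rfl⟩) (ht k).le)
  obtain ⟨v, -, φ, hφ, hv⟩ := (isCompact_closedBall (0 : F) C).tendsto_subseq hbd
  refine ⟨v, _, φ, hφ, hv, fun k => ?_⟩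
  rw [Function.comp_apply, smul_smul, mul_inv_cancel₀ (ht _).ne', one_smul, add_sub_cancel]

end Intermediate

/-! ### Chain rules: tangents and polarity -/

section Composition

variable {E F G : Type*} [NormedAddCommGroup E] [InnerProductSpace ℝ E]
  [NormedAddCommGroup F] [InnerProductSpace ℝ F]
  [NormedAddCommGroup G] [InnerProductSpace ℝ G]
  {S₁ : E → Set F} {S₂ : F → Set G} {x : E} {z : G}

lemma graphicalDeriv_compose_subset [FiniteDimensional ℝ F]
    (hS₁ : IsClosed (gph S₁)) (hS₂ : IsClosed (gph S₂))
    (hxz : pair x z ∈ gph (compose S₂ S₁))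
    (hcalm : FuzzyInnerCalmStarAt (intermediate S₁ S₂) (pair x z) (dom (intermediate S₁ S₂)))
    (u : E) :
    graphicalDeriv (compose S₂ S₁) x z u ⊆ ⋃ y ∈ intermediate S₁ S₂ (pair x z),
      compose (graphicalDeriv S₂ y z) (graphicalDeriv S₁ x y) u := by
  intro w hw
  simp only [Set.mem_iUnion, compose, exists_prop]
  -- The zero direction cannot be normalised, but there any intermediate point works with `v = 0`.
  by_cases h0 : pair u w = 0
  · obtain ⟨y, hy₁, hy₂⟩ := Set.mem_iUnion₂.1 hxz
    have hu : u = 0 := congrArg WithLp.fst h0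
    have hw0 : w = 0 := congrArg WithLp.snd h0
    subst hu hw0
    exact ⟨y, ⟨hy₁, hy₂⟩, 0, zero_mem_tangentCone hy₁, zero_mem_tangentCone hy₂⟩
  · have hc : 0 < ‖pair u w‖ := norm_pos_iff.2 h0
    set c := ‖pair u w‖
    have hunit : ‖c⁻¹ • pair u w‖ = 1 := by
      rw [norm_smul, norm_inv, norm_norm, inv_mul_cancel₀ hc.ne']
    have htan : c⁻¹ • pair u w ∈ tangentCone (dom (intermediate S₁ S₂)) (pair x z) := by
      rw [dom_intermediate]
      exact smul_mem_tangentCone hw (inv_pos.2 hc)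
    obtain ⟨κ, -, ps, y, ys, -, ⟨t, ds, ht, ht0, hds, hps⟩, hys⟩ :=
      (hcalm _ hunit).resolve_left (not_not_intro htan)
    simp only [hps] at hys
    obtain ⟨hy, v, vs, φ, hφ, hvs, heq⟩ := exists_subseq_intermediate_direction hS₁ hS₂ ht ht0 hds
      (fun k => (hys k).1) (fun k => (hys k).2)
    have hmem : ∀ k, y + t (φ k) • vs k ∈
        intermediate S₁ S₂ (pair x z + t (φ k) • ds (φ k)) := fun k => heq k ▸ (hys (φ k)).1
    have hdφ := hds.comp hφ.tendsto_atTop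
    have h₁ : pair (c⁻¹ • u) v ∈ tangentCone (gph S₁) (pair x y) :=
      ⟨hy.1, t ∘ φ, fun k => pair (ds (φ k)).fst (vs k), fun k => ht _,
        ht0.comp hφ.tendsto_atTop, Tendsto.pair (Tendsto.fst hdφ) hvs, fun k => (hmem k).1⟩
    have h₂ : pair v (c⁻¹ • w) ∈ tangentCone (gph S₂) (pair y z) :=
      ⟨hy.2, t ∘ φ, fun k => pair (vs k) (ds (φ k)).snd, fun k => ht _,
        ht0.comp hφ.tendsto_atTop, Tendsto.pair hvs (Tendsto.snd hdφ), fun k => (hmem k).2⟩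
    have h₁' : pair (c • c⁻¹ • u) (c • v) ∈ tangentCone (gph S₁) (pair x y) :=
      smul_mem_tangentCone h₁ hc
    have h₂' : pair (c • v) (c • c⁻¹ • w) ∈ tangentCone (gph S₂) (pair y z) :=
      smul_mem_tangentCone h₂ hc
    rw [smul_inv_smul₀ hc.ne'] at h₁' h₂'
    exact ⟨y, hy, c • v, h₁', h₂'⟩

/-- The product condition supplies the same step lengths for both graphs. The two intermediate
points then differ by `o(tₖ)`, and calmness moves them to a coupled point without changing the
direction. -/
lemma compose_graphicalDeriv_subset {y : F} (hy : y ∈ intermediate S₁ S₂ (pair x z))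
    (hcalm : CalmAt (perturbation S₁ S₂) (pair 0 0) (pair x (pair z y)))
    (hprod : TangentProductCondition S₁ S₂ x y z) (u : E) :
    compose (graphicalDeriv S₂ y z) (graphicalDeriv S₁ x y) u ⊆
      graphicalDeriv (compose S₂ S₁) x z u := by
  intro w hw
  obtain ⟨v, hv, hw⟩ := Set.mem_iUnion₂.1 hw
  obtain ⟨-, t, ds, ht, ht0, hds, hmem⟩ := (hprod u v w).2 ⟨hv, hw⟩
  obtain ⟨κ, hκ, hcalm⟩ := hcalm.exists_calmNear
  have hu := Tendsto.fst (Tendsto.fst hds)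
  have hv₁ := Tendsto.snd (Tendsto.fst hds)
  have hv₂ := Tendsto.fst (Tendsto.snd hds)
  have hw := Tendsto.snd (Tendsto.snd hds)
  have hdir : Tendsto (fun k => pair (ds k).fst.fst (pair (ds k).snd.snd (ds k).snd.fst)) atTop
      (𝓝 (pair u (pair w v))) := Tendsto.pair hu (Tendsto.pair hw hv₂)
  have hs : Tendsto (fun k => pair x (pair z y) +
      t k • pair (ds k).fst.fst (pair (ds k).snd.snd (ds k).snd.fst)) atTop
      (𝓝 (pair x (pair z y))) := by
    simpa using tendsto_const_nhds.add (ht0.smul hdir)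
  -- Tangency requires membership for every `k`, so the sequence is shifted past `N`.
  obtain ⟨N, hN⟩ := eventually_atTop.1 (hs.eventually hcalm)
  have hnear : ∀ k, ∃ s ∈ perturbation S₁ S₂ (pair 0 0),
      ‖s - (pair x (pair z y) + t (k + N) •
        pair (ds (k + N)).fst.fst (pair (ds (k + N)).snd.snd (ds (k + N)).snd.fst))‖ ≤
      t (k + N) * (κ * ‖(ds (k + N)).fst.snd - (ds (k + N)).snd.fst‖) := by
    intro k
    have hM : (pair x (pair z y) + t (k + N) •
        pair (ds (k + N)).fst.fst (pair (ds (k + N)).snd.snd (ds (k + N)).snd.fst)) ∈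
        perturbation S₁ S₂
          (pair (t (k + N) • ((ds (k + N)).fst.snd - (ds (k + N)).snd.fst)) 0) := by
      obtain ⟨h₁, h₂⟩ := hmem (k + N)
      refine ⟨?_, ?_⟩
      · change y + t (k + N) • (ds (k + N)).snd.fst +
          t (k + N) • ((ds (k + N)).fst.snd - (ds (k + N)).snd.fst) ∈ _
        rw [smul_sub, add_assoc, add_sub_cancel]
        exact h₁
      · change z + t (k + N) • (ds (k + N)).snd.snd + 0 ∈ _
        rw [add_zero]
        exact h₂
    obtain ⟨s, hs, hle⟩ := hN (k + N) (Nat.le_add_left _ _) _ hM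
    refine ⟨s, hs, ?_⟩
    rw [norm_sub_rev]
    refine hle.trans ?_
    have := norm_pair_sub_le (t (k + N) • ((ds (k + N)).fst.snd - (ds (k + N)).snd.fst)) 0
      (0 : G) 0
    rw [sub_zero, sub_zero, norm_zero, add_zero, norm_smul, Real.norm_of_nonneg (ht _).le] at this
    calc _ ≤ κ * (t (k + N) * ‖(ds (k + N)).fst.snd - (ds (k + N)).snd.fst‖) := by gcongr
      _ = _ := by ring
  choose s hs hclose using hnear
  have hshift := tendsto_add_atTop_nat N
  have hr : Tendsto (fun k => κ * ‖(ds (k + N)).fst.snd - (ds (k + N)).snd.fst‖) atTop (𝓝 0) := by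
    have := ((hv₁.sub hv₂).norm.const_mul κ).comp hshift
    simpa [Function.comp_def] using this
  obtain ⟨ws, hws, heq⟩ := exists_direction_of_near (fun k => ht (k + N))
    (hdir.comp hshift) hr hclose
  refine ⟨Set.mem_biUnion hy.1 hy.2, fun k => t (k + N),
    fun k => pair (ws k).fst (ws k).snd.fst, fun k => ht _, ht0.comp hshift,
    Tendsto.pair (Tendsto.fst hws) (Tendsto.fst (Tendsto.snd hws)), fun k => ?_⟩
  obtain ⟨h₁, h₂⟩ := hs k
  rw [heq k] at h₁ h₂
  simp only [WithLp.toLp_fst, WithLp.toLp_snd, add_zero] at h₁ h₂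
  exact Set.mem_biUnion h₁ h₂

/-- Adding `⟨x*, u⟩ ≤ ⟨y*, v⟩` and `⟨y*, v⟩ ≤ ⟨z*, w⟩` eliminates `v`. The point `y` depends on the
tangent direction, whence the intersection over all `y`. -/
lemma subset_regularCoderiv_compose [FiniteDimensional ℝ F]
    (hS₁ : IsClosed (gph S₁)) (hS₂ : IsClosed (gph S₂))
    (hxz : pair x z ∈ gph (compose S₂ S₁))
    (hcalm : FuzzyInnerCalmStarAt (intermediate S₁ S₂) (pair x z) (dom (intermediate S₁ S₂)))
    (zs : G) :
    (⋂ y ∈ intermediate S₁ S₂ (pair x z),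
      compose (regularCoderiv S₁ x y) (regularCoderiv S₂ y z) zs) ⊆
      regularCoderiv (compose S₂ S₁) x z zs := by
  intro xs hxs
  refine ⟨hxz, fun d hd => ?_⟩
  obtain ⟨y, hy, hd⟩ := Set.mem_iUnion₂.1
    (graphicalDeriv_compose_subset hS₁ hS₂ hxz hcalm d.fst (show d.snd ∈ _ from hd))
  obtain ⟨v, hv, hw⟩ := Set.mem_iUnion₂.1 hd
  obtain ⟨ys, hys, hxs⟩ := Set.mem_iUnion₂.1 (Set.mem_iInter₂.1 hxs y hy)
  have h₁ := hxs.2 _ hv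
  have h₂ := hys.2 _ hw
  rw [inner_pair, inner_neg_left] at h₁ h₂
  change inner ℝ (pair xs (-zs)) (pair d.fst d.snd) ≤ 0
  rw [inner_pair, inner_neg_left]
  linarith

/-! ### Chain rules: limiting and directional normals -/

variable [FiniteDimensional ℝ E] [FiniteDimensional ℝ F] [FiniteDimensional ℝ G]

/-- Regular normals to the graph of a composition, at points where the perturbation mapping is
calm with a common constant, split in the limit. -/
lemma exists_limit_split (hS₁ : IsClosed (gph S₁)) (hS₂ : IsClosed (gph S₂))
    {ps : ℕ → EProd E G} {yk : ℕ → F} (hy : ∀ k, yk k ∈ intermediate S₁ S₂ (ps k))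
    {κ : ℝ} (hκ : 0 < κ)
    (hcalm : ∀ k, CalmNear (perturbation S₁ S₂) κ (pair 0 0)
      (pair (ps k).fst (pair (ps k).snd (yk k))))
    {ns : ℕ → EProd E G} {xs : E} {zs : G} (hns : Tendsto ns atTop (𝓝 (pair xs (-zs))))
    (hn : ∀ k, ns k ∈ regularNormal (gph (compose S₂ S₁)) (ps k))
    {ε : ℕ → ℝ} (hε : ∀ k, 0 < ε k) (hε1 : ∀ k, ε k ≤ 1) (hε0 : Tendsto ε atTop (𝓝 0)) :
    ∃ (φ : ℕ → ℕ) (ys : F) (a n₁ : ℕ → EProd E F) (b n₂ : ℕ → EProd F G), StrictMono φ ∧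
      Tendsto n₁ atTop (𝓝 (pair xs (-ys))) ∧ Tendsto n₂ atTop (𝓝 (pair ys (-zs))) ∧
      (∀ k, ‖a k - pair (ps (φ k)).fst (yk (φ k))‖ ≤ ε (φ k)) ∧
      (∀ k, ‖b k - pair (yk (φ k)) (ps (φ k)).snd‖ ≤ ε (φ k)) ∧
      (∀ k, n₁ k ∈ regularNormal (gph S₁) (a k)) ∧
      ∀ k, n₂ k ∈ regularNormal (gph S₂) (b k) := by
  have hnf := Tendsto.fst hns
  have hng : Tendsto (fun k => -(ns k).snd) atTop (𝓝 zs) := by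
    simpa using (Tendsto.snd hns).neg
  obtain ⟨B, hB⟩ := (hnf.norm.add hng.norm).bddAbove_range
  have hsplit := fun k => exists_regularNormal_split (xs := (ns k).fst) (zs := -(ns k).snd)
    hS₁ hS₂ (hy k).1 (hy k).2 hκ (hcalm k) (by rw [neg_neg]; exact hn k) (hB ⟨k, rfl⟩)
    (hε k) (hε1 k)
  choose a b e₁ ysk e₂ e₃ ha hb he₁ he₂ he₃ hys hn₁ hn₂ using hsplit
  have : ProperSpace F := FiniteDimensional.proper ℝ F
  -- The multipliers stay in a ball independent of `k`, since `B` and `κ` are.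
  obtain ⟨ys, -, φ, hφ, hlim⟩ := (isCompact_closedBall (0 : F) ((B + 1) * κ + 1)).tendsto_subseq
    (fun k => mem_closedBall_zero_iff.2 (hys k))
  have h₁ := (squeeze_zero_norm he₁ hε0).comp hφ.tendsto_atTop
  have h₂ := (squeeze_zero_norm he₂ hε0).comp hφ.tendsto_atTop
  have h₃ := (squeeze_zero_norm he₃ hε0).comp hφ.tendsto_atTop
  refine ⟨φ, ys, a ∘ φ, _, b ∘ φ, _, hφ, ?_, ?_, fun k => ha _, fun k => hb _,
    fun k => hn₁ (φ k), fun k => hn₂ (φ k)⟩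
  · have := (hnf.comp hφ.tendsto_atTop).sub h₁
    rw [sub_zero] at this
    exact Tendsto.pair this hlim.neg
  · have h₄ := hlim.sub h₂
    have h₅ := (hng.comp hφ.tendsto_atTop).add h₃
    rw [sub_zero] at h₄
    rw [add_zero] at h₅
    exact Tendsto.pair h₄ h₅.neg

/-- Limits of regular normals to the graph of a composition, taken along convergent intermediate
points, belong to the composition of the limiting coderivatives. -/
lemma mem_compose_limitingCoderiv_of_tendsto (hS₁ : IsClosed (gph S₁)) (hS₂ : IsClosed (gph S₂))
    {y : F} (hcalm : CalmAt (perturbation S₁ S₂) (pair 0 0) (pair x (pair z y)))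
    {ps : ℕ → EProd E G} {yk : ℕ → F} (hps : Tendsto ps atTop (𝓝 (pair x z)))
    (hyk : Tendsto yk atTop (𝓝 y)) (hy : ∀ k, yk k ∈ intermediate S₁ S₂ (ps k))
    {ns : ℕ → EProd E G} {xs : E} {zs : G} (hns : Tendsto ns atTop (𝓝 (pair xs (-zs))))
    (hn : ∀ k, ns k ∈ regularNormal (gph (compose S₂ S₁)) (ps k)) :
    xs ∈ compose (limitingCoderiv S₁ x y) (limitingCoderiv S₂ y z) zs := by
  obtain ⟨κ, hκ, hcalm⟩ := hcalm.exists_calmNear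
  have hpf := Tendsto.fst hps
  have hpg := Tendsto.snd hps
  have hlim := Tendsto.pair hpf (Tendsto.pair hpg hyk)
  -- `eventually_nhds` transfers calmness at the limit to the nearby points with the same `κ`.
  obtain ⟨N, hN⟩ := eventually_atTop.1 (hlim.eventually hcalm.eventually_nhds)
  have hshift := tendsto_add_atTop_nat N
  obtain ⟨φ, ys, a, n₁, b, n₂, hφ, hl₁, hl₂, ha, hb, hn₁, hn₂⟩ := exists_limit_split hS₁ hS₂
    (fun k => hy (k + N)) hκ (fun k => hN (k + N) (Nat.le_add_left _ _)) (hns.comp hshift)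
    (fun k => hn (k + N)) (ε := fun k => 1 / ((k : ℝ) + 1)) (fun k => by positivity)
    (fun k => by rw [div_le_one (by positivity)]; linarith [k.cast_nonneg (α := ℝ)])
    tendsto_one_div_add_atTop_nhds_zero_nat
  have hε := tendsto_one_div_add_atTop_nhds_zero_nat (𝕜 := ℝ).comp hφ.tendsto_atTop
  have hσ := hshift.comp hφ.tendsto_atTop
  have hyx := mem_intermediate_of_tendsto hS₁ hS₂ hps hyk hy
  have ha' : Tendsto a atTop (𝓝 (pair x y)) := by
    have := (Tendsto.pair hpf hyk).comp hσ
    have h2 := (squeeze_zero_norm ha hε).add this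
    simpa using h2
  have hb' : Tendsto b atTop (𝓝 (pair y z)) := by
    have := (Tendsto.pair hyk hpg).comp hσ
    have h2 := (squeeze_zero_norm hb hε).add this
    simpa using h2
  exact Set.mem_biUnion (show ys ∈ limitingCoderiv S₂ y z zs from ⟨hyx.2, b, n₂, hb', hl₂, hn₂⟩)
    ⟨hyx.1, a, n₁, ha', hl₁, hn₁⟩

/-- Constant sequences suffice. Limiting coderivatives appear because splitting yields regular
normals only at nearby points of the graphs. -/
lemma regularCoderiv_compose_subset (hS₁ : IsClosed (gph S₁)) (hS₂ : IsClosed (gph S₂))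
    (hcalm : ∀ y ∈ intermediate S₁ S₂ (pair x z),
      CalmAt (perturbation S₁ S₂) (pair 0 0) (pair x (pair z y))) (zs : G) :
    regularCoderiv (compose S₂ S₁) x z zs ⊆ ⋂ y ∈ intermediate S₁ S₂ (pair x z),
      compose (limitingCoderiv S₁ x y) (limitingCoderiv S₂ y z) zs := fun _ hxs =>
  Set.mem_iInter₂.2 fun y hy => mem_compose_limitingCoderiv_of_tendsto hS₁ hS₂ (hcalm y hy)
    tendsto_const_nhds tendsto_const_nhds (fun _ => hy) tendsto_const_nhds (fun _ => hxs)

lemma limitingCoderiv_compose_subset (hS₁ : IsClosed (gph S₁)) (hS₂ : IsClosed (gph S₂))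
    (hsemi : InnerSemicompactAt (intermediate S₁ S₂) (pair x z) (dom (intermediate S₁ S₂)))
    (hcalm : ∀ y ∈ intermediate S₁ S₂ (pair x z),
      CalmAt (perturbation S₁ S₂) (pair 0 0) (pair x (pair z y))) (zs : G) :
    limitingCoderiv (compose S₂ S₁) x z zs ⊆ ⋃ y ∈ intermediate S₁ S₂ (pair x z),
      compose (limitingCoderiv S₁ x y) (limitingCoderiv S₂ y z) zs := by
  rintro xs ⟨-, ps, ns, hps, hns, hn⟩
  obtain ⟨y, yk, φ, hφ, hyk, hmem⟩ := hsemi ps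
    (fun k => by rw [dom_intermediate]; exact (hn k).1) hps
  have hpφ := hps.comp hφ.tendsto_atTop
  have hy := mem_intermediate_of_tendsto hS₁ hS₂ hpφ hyk hmem
  exact Set.mem_biUnion hy (mem_compose_limitingCoderiv_of_tendsto hS₁ hS₂ (hcalm y hy)
    hpφ hyk hmem (hns.comp hφ.tendsto_atTop) (fun k => hn (φ k)))

lemma dirLimitingCoderiv_compose_subset (hS₁ : IsClosed (gph S₁)) (hS₂ : IsClosed (gph S₂))
    {u : E} {w : G}
    (hinner : InnerCalmStarAtDir (intermediate S₁ S₂) (pair x z) (dom (intermediate S₁ S₂))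
      (pair u w))
    (hcalm : ∀ y ∈ intermediate S₁ S₂ (pair x z),
      ∀ v ∈ graphicalDeriv (intermediate S₁ S₂) (pair x z) y (pair u w),
        CalmAtDir (perturbation S₁ S₂) (pair 0 0) (pair x (pair z y)) (pair u (pair w v)))
    (zs : G) :
    dirLimitingCoderiv (compose S₂ S₁) x z u w zs ⊆
      ⋃ y ∈ intermediate S₁ S₂ (pair x z),
        ⋃ v ∈ graphicalDeriv (intermediate S₁ S₂) (pair x z) y (pair u w),
          compose (dirLimitingCoderiv S₁ x y u v) (dirLimitingCoderiv S₂ y z v w) zs := by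
  rintro xs ⟨-, t, ds, ns, ht, ht0, hds, hns, hn⟩
  obtain ⟨κ₀, -, hinner⟩ := hinner
  obtain ⟨y, yk, φ, hφ, hyk⟩ := hinner (fun k => pair x z + t k • ds k)
    (fun k => by rw [dom_intermediate]; exact (hn k).1) ⟨t, ds, ht, ht0, hds, fun k => rfl⟩
  obtain ⟨hy, v, vs, ψ, hψ, hvs, heq⟩ := exists_subseq_intermediate_direction hS₁ hS₂
    (fun k => ht (φ k)) (ht0.comp hφ.tendsto_atTop) (hds.comp hφ.tendsto_atTop)
    (fun k => (hyk k).2) (fun k => (hyk k).1)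
  have hφψ := hφ.tendsto_atTop.comp hψ.tendsto_atTop
  have htψ : Tendsto (fun k => t (φ (ψ k))) atTop (𝓝 0) := ht0.comp hφψ
  have hdψ : Tendsto (fun k => ds (φ (ψ k))) atTop (𝓝 (pair u w)) := hds.comp hφψ
  have hmem : ∀ k, y + t (φ (ψ k)) • vs k ∈
      intermediate S₁ S₂ (pair x z + t (φ (ψ k)) • ds (φ (ψ k))) := fun k =>
    heq k ▸ (hyk (ψ k)).2
  have hv : v ∈ graphicalDeriv (intermediate S₁ S₂) (pair x z) y (pair u w) :=
    ⟨hy, fun k => t (φ (ψ k)), fun k => pair (ds (φ (ψ k))) (vs k), fun k => ht _, htψ,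
      Tendsto.pair hdψ hvs, hmem⟩
  obtain ⟨κ, hκ, hnear⟩ := (hcalm y hy v hv).exists_calmNear
  have hu' := Tendsto.fst hdψ
  have hw' := Tendsto.snd hdψ
  obtain ⟨N, hN⟩ := eventually_atTop.1 (hnear _ _ (fun k => ht (φ (ψ k))) htψ
    (Tendsto.pair hu' (Tendsto.pair hw' hvs)))
  have hshift := tendsto_add_atTop_nat N
  set T : ℕ → ℝ := fun k => t (φ (ψ (k + N))) with hT
  have hT0 : Tendsto T atTop (𝓝 0) := htψ.comp hshift
  have hone := tendsto_one_div_add_atTop_nhds_zero_nat (𝕜 := ℝ)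
  obtain ⟨χ, ys, a, n₁, b, n₂, hχ, hl₁, hl₂, ha, hb, hn₁, hn₂⟩ := exists_limit_split hS₁ hS₂
    (fun k => hmem (k + N)) hκ (fun k => hN (k + N) (Nat.le_add_left _ _))
    ((hns.comp hφψ).comp hshift) (fun k => hn (φ (ψ (k + N))))
    -- Errors of order `o(Tₖ)` keep the split points converging from the prescribed directions.
    (ε := fun k => min 1 (T k * (1 / ((k : ℝ) + 1))))
    (fun k => lt_min one_pos (mul_pos (ht _) (by positivity))) (fun k => min_le_left _ _)
    (by simpa using (tendsto_const_nhds (x := (1 : ℝ))).min (hT0.mul hone))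
  have hrχ := hone.comp hχ.tendsto_atTop
  have hσ := hshift.comp hχ.tendsto_atTop
  refine Set.mem_biUnion hy (Set.mem_biUnion hv (Set.mem_biUnion
    (show ys ∈ dirLimitingCoderiv S₂ y z v w zs from ?_) ?_))
  · exact mem_dirLimitingNormal_of_near hy.2 (fun k => ht _) (hT0.comp hχ.tendsto_atTop)
      ((Tendsto.pair hvs hw').comp hσ) hrχ (fun k => (hb k).trans (min_le_right _ _)) hl₂ hn₂
  · exact mem_dirLimitingNormal_of_near hy.1 (fun k => ht _) (hT0.comp hχ.tendsto_atTop)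
      ((Tendsto.pair hu' hvs).comp hσ) hrχ (fun k => (ha k).trans (min_le_right _ _)) hl₁ hn₁

end Composition

end VariationalAnalysis

theorem mainTheorem9 {n m l : ℕ}
    (S₁ : EuclideanSpace ℝ (Fin n) → Set (EuclideanSpace ℝ (Fin m)))
    (S₂ : EuclideanSpace ℝ (Fin m) → Set (EuclideanSpace ℝ (Fin l)))
    (hS₁ : IsClosed (gph S₁)) (hS₂ : IsClosed (gph S₂))
    (x : EuclideanSpace ℝ (Fin n)) (z : EuclideanSpace ℝ (Fin l))
    (hxz : pair x z ∈ gph (compose S₂ S₁))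
    (hloc : LocallyClosedAt (gph (compose S₂ S₁)) (pair x z)) :
    -- graphical derivative
    (FuzzyInnerCalmStarAt (intermediate S₁ S₂) (pair x z) (dom (intermediate S₁ S₂)) →
      ∀ u, graphicalDeriv (compose S₂ S₁) x z u ⊆
        ⋃ y ∈ intermediate S₁ S₂ (pair x z),
          compose (graphicalDeriv S₂ y z) (graphicalDeriv S₁ x y) u) ∧
    ((∀ y ∈ intermediate S₁ S₂ (pair x z),
        CalmAt (perturbation S₁ S₂) (pair 0 0) (pair x (pair z y)) ∧
        TangentProductCondition S₁ S₂ x y z) →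
      ∀ u, (⋃ y ∈ intermediate S₁ S₂ (pair x z),
          compose (graphicalDeriv S₂ y z) (graphicalDeriv S₁ x y) u) ⊆
        graphicalDeriv (compose S₂ S₁) x z u) ∧
    -- regular coderivative
    (FuzzyInnerCalmStarAt (intermediate S₁ S₂) (pair x z) (dom (intermediate S₁ S₂)) →
      ∀ zs, (⋂ y ∈ intermediate S₁ S₂ (pair x z),
          compose (regularCoderiv S₁ x y) (regularCoderiv S₂ y z) zs) ⊆
        regularCoderiv (compose S₂ S₁) x z zs) ∧
    ((∀ y ∈ intermediate S₁ S₂ (pair x z),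
        CalmAt (perturbation S₁ S₂) (pair 0 0) (pair x (pair z y))) →
      ∀ zs, regularCoderiv (compose S₂ S₁) x z zs ⊆
        ⋂ y ∈ intermediate S₁ S₂ (pair x z),
          compose (limitingCoderiv S₁ x y) (limitingCoderiv S₂ y z) zs) ∧
    -- limiting coderivative
    (InnerSemicompactAt (intermediate S₁ S₂) (pair x z) (dom (intermediate S₁ S₂)) →
      (∀ y ∈ intermediate S₁ S₂ (pair x z),
        CalmAt (perturbation S₁ S₂) (pair 0 0) (pair x (pair z y))) →
      ∀ zs, limitingCoderiv (compose S₂ S₁) x z zs ⊆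
        ⋃ y ∈ intermediate S₁ S₂ (pair x z),
          compose (limitingCoderiv S₁ x y) (limitingCoderiv S₂ y z) zs) ∧
    -- directional limiting coderivative
    (∀ u w,
      InnerCalmStarAtDir (intermediate S₁ S₂) (pair x z) (dom (intermediate S₁ S₂)) (pair u w) →
      (∀ y ∈ intermediate S₁ S₂ (pair x z),
        ∀ v ∈ graphicalDeriv (intermediate S₁ S₂) (pair x z) y (pair u w),
          CalmAtDir (perturbation S₁ S₂) (pair 0 0) (pair x (pair z y)) (pair u (pair w v))) →
      ∀ zs, dirLimitingCoderiv (compose S₂ S₁) x z u w zs ⊆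
        ⋃ y ∈ intermediate S₁ S₂ (pair x z),
          ⋃ v ∈ graphicalDeriv (intermediate S₁ S₂) (pair x z) y (pair u w),
            compose (dirLimitingCoderiv S₁ x y u v)
              (dirLimitingCoderiv S₂ y z v w) zs) := by
  refine ⟨fun h u => graphicalDeriv_compose_subset hS₁ hS₂ hxz h u,
    fun h u => Set.iUnion₂_subset fun y hy =>
      compose_graphicalDeriv_subset hy (h y hy).1 (h y hy).2 u,
    fun h zs => subset_regularCoderiv_compose hS₁ hS₂ hxz h zs,
    fun h zs => regularCoderiv_compose_subset hS₁ hS₂ h zs,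
    fun h h' zs => limitingCoderiv_compose_subset hS₁ hS₂ h h' zs,
    fun u w h h' zs => dirLimitingCoderiv_compose_subset hS₁ hS₂ h h' zs⟩
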